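/- Let $N\ge 2$ be an integer, let $\mathbb{T}$ be the unit circle with Lebesgue measure (functions on $\mathbb{T}$ are identified with $2\pi$-periodic functions of $\theta\in\mathbb{R}$ through $z=e^{i\theta}$), and for functions $m_0,f:\mathbb{T}\to\mathbb{C}$ put $$Rf(z)=\frac1N\sum_{w\in\mathbb{T},\;w^N=z}|m_0(w)|^2f(w)\qquad(z\in\mathbb{T}).$$ Assume that $m_0$ is Lipschitz, that $m_0$ has only finitely many zeros on $\mathbb{T}$, that $m_0=\sqrt N$ at $\theta=0$ (that is, at $z=1$), and that $R1=1$, i.e. $\frac1N\sum_{w^N=z}|m_0(w)|^2=1$ for all $z\in\mathbb{T}$. Let $1\le p<\infty$. Then $R$ induces a well-defined bounded linear operator on the complex space $L^p(\mathbb{T})$, and: 1. The spectral radius of $R:L^p(\mathbb{T})\to L^p(\mathbb{T})$ equals $N^{1/p}$, and its spectrum is the closed disk $\{\lambda\in\mathbb{C} : |\lambda|\le N^{1/p}\}$. 2. Every $\lambda\in\mathbb{C}$ with $|\lambda|<N^{1/p}$ is an eigenvalue of $R$ on $L^p(\mathbb{T})$ of infinite multiplicity, i.e. the eigenspace $\{f\in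 L^p(\mathbb{T}) : Rf=\lambda f\}$ is infinite-dimensional. 3. No $\lambda\in\mathbb{C}$ with $|\lambda|=N^{1/p}$ is an eigenvalue of $R$ on $L^p(\mathbb{T})$. -/

import Mathlib

open MeasureTheory
open scoped ENNReal NNReal

noncomputable section

/-- The circle `𝕋`, as `ℝ / 2πℤ`: functions on the unit circle are identified with `2π`-periodic
functions on `ℝ`. Its group law is written additively, so `w ↦ w ^ N` on the unit circle is
`w ↦ N • w` here. It carries Mathlib's arc-length metric and its Lebesgue measure of
total mass `2π`. -/
abbrev Torus : Type := AddCircle (2 * Real.pi)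

instance torusFact : Fact (0 < 2 * Real.pi) := ⟨Real.two_pi_pos⟩

theorem ruelleFibre_finite {N : ℕ} (hN : 0 < N) (z : Torus) : {w : Torus | N • w = z}.Finite := by
  rcases Set.eq_empty_or_nonempty {w : Torus | N • w = z} with h | ⟨w₀, hw₀⟩
  · rw [h]
    exact Set.finite_empty
  · refine ((AddCircle.finite_torsion (2 * Real.pi) hN).image (fun u => u + w₀)).subset ?_
    intro w hw
    have hw' : N • w = z := hw
    have hw₀' : N • w₀ = z := hw₀
    exact ⟨w - w₀, by simp [smul_sub, hw', hw₀'], by simp⟩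

/-- The Ruelle (wavelet Galerkin, transfer) operator on functions on `𝕋`:
`(R f)(z) = (1/N) ∑_{w ^ N = z} |m₀(w)|² f(w)`. For `N ≥ 1` the fibre `{w | N • w = z}` is finite
(`ruelleFibre_finite`), so that the sum is an ordinary finite sum. -/
def ruelle (N : ℕ) (m₀ f : Torus → ℂ) (z : Torus) : ℂ :=
  (1 / (N : ℂ)) * ∑ᶠ w ∈ {w : Torus | N • w = z}, ((‖m₀ w‖ ^ 2 : ℝ) : ℂ) * f w

/-- The bounded operator `T` on `L^p(𝕋)` is the one induced by the Ruelle operator: on the class of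
any `p`-integrable function `f` it is given by the class of `R f`. There is at most
one such `T`; its existence says that `R` is a well defined bounded operator on `L^p(𝕋)`. -/
def IsRuelleOnLp (N : ℕ) (m₀ : Torus → ℂ) (p : ℝ≥0∞) [Fact (1 ≤ p)]
    (T : Lp ℂ p (volume : Measure Torus) →L[ℂ] Lp ℂ p (volume : Measure Torus)) : Prop :=
  ∀ (f : Torus → ℂ) (hf : MemLp f p (volume : Measure Torus)),
    (T (hf.toLp f) : Torus → ℂ) =ᵐ[volume] ruelle N m₀ f

end

/-!
Write `W = |m₀|² / N`. The quadrature condition says that `W` is a probability vector on every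
fibre of `w ↦ N • w`, so `R f` is a weighted average of `f` over fibres. Since `w ↦ N • w`
preserves Lebesgue measure, Jensen's inequality gives `∫ |R f|^p ≤ N ∫ W |f|^p ≤ N ∫ |f|^p`
(`lintegral_enorm_ruelle_rpow_le`), hence `‖R‖ ≤ N^{1/p}`. If `R f = μ f` with `|μ|^p = N`, both
inequalities are equalities and `f` vanishes where `W < 1`. That is almost everywhere, because
`W w = 1` forces `m₀` to vanish on the rest of the fibre of `w`
(`IsRuelleOnLp.eq_zero_of_apply_eq_smul`).

For `|μ| < N^{1/p}` eigenfunctions are built from a right inverse of `R`. Let `s` be the branch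
`θ ↦ θ / N`, `θ ∈ (-π, π]`, of the `N`-th root (`rootSection`), and let `S f` (`branchLift`) be the
function `f (N • w) / W w` on the range of `s`, and `0` elsewhere; then `R S f = f` almost
everywhere. The orbits of `s` converge uniformly to `0`, where `W = 1`, and `s` contracts measure by
the factor `1 / N`. So the norms of `S^n g` decay like `(r N^{1/p})^{-n}`, for any `r < 1`, as soon as
`g` is carried by a set where `W` is bounded below along the orbits of `s` (`goodSet`). Hence
`H_g = ∑ μ^n S^{n+1} g` converges and solves `R H = g + μ H`
(`IsRuelleOnLp.exists_apply_eq_add_smul`). It vanishes off the range of `s`.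

For a suitable `ψ` the function `F = ψ + μ H_ψ - H_{R ψ}` therefore satisfies `R F = μ F`, and it
agrees with `ψ` off the range of `s` (`IsRuelleOnLp.exists_eigenvector_extending`). There is a set of
positive measure off the range of `s` on which `ψ` may be chosen freely
(`exists_measure_good_ne_zero`); the functions `e^{ijθ}` on that set give infinitely many
independent eigenfunctions. The spectrum is closed, contains the open disk of radius `N^{1/p}`, and
lies in the closed disk of radius `‖R‖ ≤ N^{1/p}`.
-/

noncomputable section

/-! ### Fibres of `w ↦ N • w` and a measurable section -/

/-- The generator `2π / N` of the group of `N`-torsion points of the circle. -/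
def torsionStep (N : ℕ) : Torus := ((2 * Real.pi / N : ℝ) : Torus)

theorem nsmul_torsionStep {N : ℕ} (hN : 0 < N) : N • torsionStep N = 0 := by
  have h := addOrderOf_nsmul_eq_zero (torsionStep N)
  rwa [torsionStep, AddCircle.addOrderOf_period_div hN] at h

theorem torsionStep_ne_zero {N : ℕ} (hN : 2 ≤ N) : torsionStep N ≠ 0 := by
  intro h
  have h' := AddCircle.addOrderOf_period_div (p := 2 * Real.pi) (n := N) (by omega)
  change addOrderOf (torsionStep N) = N at h'
  rw [h, addOrderOf_zero] at h'
  omega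

theorem fibre_eq_image {N : ℕ} (hN : 0 < N) (w : Torus) :
    {v : Torus | N • v = N • w} =
      (fun k : ℕ => w + k • torsionStep N) '' (Finset.range N : Set ℕ) := by
  ext v
  simp only [Set.mem_ofPred_eq, Set.mem_image, Finset.coe_range, Set.mem_Iio]
  constructor
  · intro hv
    have h0 : N • (v - w) = 0 := by rw [smul_sub, hv, sub_self]
    obtain ⟨m, hm, h⟩ := (AddCircle.nsmul_eq_zero_iff hN).mp h0
    refine ⟨m, hm, ?_⟩
    have : m • torsionStep N = v - w := by
      rw [← h, torsionStep, ← AddCircle.coe_nsmul, nsmul_eq_mul]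
      congr 1
      ring
    rw [this]
    abel
  · rintro ⟨k, -, rfl⟩
    rw [smul_add, smul_comm N k, nsmul_torsionStep hN, smul_zero, add_zero]

theorem injOn_torsion_translates {N : ℕ} (hN : 0 < N) (w : Torus) :
    Set.InjOn (fun k : ℕ => w + k • torsionStep N) (Finset.range N : Set ℕ) := by
  intro a ha b hb hab
  have hab' : a • torsionStep N = b • torsionStep N := add_left_cancel hab
  have ho : addOrderOf (torsionStep N) = N := AddCircle.addOrderOf_period_div hN
  refine nsmul_injOn_Iio_addOrderOf ?_ ?_ hab' <;> rw [ho]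
  · simpa using ha
  · simpa using hb

theorem finsum_fibre {M : Type*} [AddCommMonoid M] {N : ℕ} (hN : 0 < N) (h : Torus → M)
    (w : Torus) :
    ∑ᶠ v ∈ {v : Torus | N • v = N • w}, h v =
      ∑ k ∈ Finset.range N, h (w + k • torsionStep N) := by
  rw [fibre_eq_image hN, finsum_mem_image (injOn_torsion_translates hN w), finsum_mem_coe_finset]

/-- The measurable section `z ↦ x / N` of `w ↦ N • w`, where `x ∈ (-π, π]` represents `z`. The
symmetric interval makes it a contraction towards `0`. -/
def rootSection (N : ℕ) (z : Torus) : Torus :=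
  (((AddCircle.measurableEquivIoc (2 * Real.pi) (-Real.pi) z : ℝ) / N : ℝ) : Torus)

theorem measurable_rootSection (N : ℕ) : Measurable (rootSection N) :=
  AddCircle.measurable_mk'.comp
    ((measurable_subtype_coe.comp
      (AddCircle.measurableEquivIoc (2 * Real.pi) (-Real.pi)).measurable).div_const _)

theorem coe_measurableEquivIoc (z : Torus) :
    ((AddCircle.measurableEquivIoc (2 * Real.pi) (-Real.pi) z : ℝ) : Torus) = z :=
  (AddCircle.measurableEquivIoc (2 * Real.pi) (-Real.pi)).symm_apply_apply z

theorem nsmul_rootSection {N : ℕ} (hN : 0 < N) (z : Torus) : N • rootSection N z = z := by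
  conv_rhs => rw [← coe_measurableEquivIoc z]
  rw [rootSection, ← AddCircle.coe_nsmul, nsmul_eq_mul, mul_div_cancel₀]
  exact_mod_cast hN.ne'

theorem norm_rootSection_le {N : ℕ} (hN : 0 < N) (z : Torus) : ‖rootSection N z‖ ≤ ‖z‖ / N := by
  have hpi := Real.pi_pos
  have hx := (AddCircle.measurableEquivIoc (2 * Real.pi) (-Real.pi) z).2
  have hz := coe_measurableEquivIoc z
  rw [rootSection]
  set x : ℝ := (AddCircle.measurableEquivIoc (2 * Real.pi) (-Real.pi) z : ℝ)
  have hxa : |x| ≤ |2 * Real.pi| / 2 := by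
    rw [abs_of_pos (by positivity : 0 < 2 * Real.pi), abs_le]
    constructor <;> linarith [hx.1, hx.2]
  have hNr : (1 : ℝ) ≤ N := by exact_mod_cast hN
  have h2 : |x / N| = |x| / N := by rw [abs_div, Nat.abs_cast]
  have hxa' : |x / N| ≤ |2 * Real.pi| / 2 := by
    rw [h2]
    exact (div_le_self (abs_nonneg _) hNr).trans hxa
  rw [(AddCircle.norm_coe_eq_abs_iff _ (by positivity)).mpr hxa', h2, ← hz,
    (AddCircle.norm_coe_eq_abs_iff _ (by positivity)).mpr hxa]

theorem norm_iterate_rootSection_le {N : ℕ} (hN : 0 < N) (n : ℕ) (z : Torus) :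
    ‖(rootSection N)^[n] z‖ ≤ Real.pi / (N : ℝ) ^ n := by
  induction n with
  | zero =>
    have := AddCircle.norm_le_half_period (2 * Real.pi) (x := z) (by positivity)
    rw [abs_of_pos (by positivity : 0 < 2 * Real.pi)] at this
    simpa using this
  | succ n ih =>
    rw [Function.iterate_succ_apply']
    refine (norm_rootSection_le hN _).trans ?_
    rw [pow_succ, ← div_div]
    gcongr

instance : NullSingletonClass (volume : Measure Torus) where
  measure_singleton z := by
    rw [← Metric.closedBall_zero, AddCircle.volume_closedBall]
    simp

theorem measurePreserving_nsmul_torus {N : ℕ} (hN : 2 ≤ N) :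
    MeasurePreserving (fun w : Torus => N • w) volume volume :=
  (AddCircle.ergodic_nsmul hN).toMeasurePreserving

theorem quasiMeasurePreserving_rootSection {N : ℕ} (hN : 2 ≤ N) :
    Measure.QuasiMeasurePreserving (rootSection N) (volume : Measure Torus) volume := by
  have hN0 : 0 < N := by omega
  refine ⟨measurable_rootSection N, Measure.AbsolutelyContinuous.mk fun s hs hs0 => ?_⟩
  rw [Measure.map_apply (measurable_rootSection N) hs,
    ← (measurePreserving_nsmul_torus hN).measure_preimage
      (measurable_rootSection N hs).nullMeasurableSet]
  have hsub : (fun w : Torus => N • w) ⁻¹' (rootSection N ⁻¹' s) ⊆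
      ⋃ k : ℕ, (fun w : Torus => w + k • torsionStep N) ⁻¹' s := by
    intro w hw
    have hmem : rootSection N (N • w) ∈ {v : Torus | N • v = N • w} :=
      nsmul_rootSection hN0 _
    rw [fibre_eq_image hN0] at hmem
    obtain ⟨k, -, hk⟩ := hmem
    refine Set.mem_iUnion.mpr ⟨k, ?_⟩
    change w + k • torsionStep N ∈ s
    have hk' : w + k • torsionStep N = rootSection N (N • w) := hk
    rw [hk']
    exact hw
  refine measure_mono_null hsub (measure_iUnion_null fun k => ?_)
  rw [(measurePreserving_add_right volume (k • torsionStep N)).measure_preimage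
    hs.nullMeasurableSet, hs0]

theorem quasiMeasurePreserving_rootSection_add {N : ℕ} (hN : 2 ≤ N) (k : ℕ) :
    Measure.QuasiMeasurePreserving (fun z => rootSection N z + k • torsionStep N)
      (volume : Measure Torus) volume :=
  (measurePreserving_add_right volume (k • torsionStep N)).quasiMeasurePreserving.comp
    (quasiMeasurePreserving_rootSection hN)

/-- The image of `rootSection N`, which meets every fibre of `w ↦ N • w` exactly once. -/
def sectionRange (N : ℕ) : Set Torus := {w | rootSection N (N • w) = w}

theorem measurableSet_sectionRange (N : ℕ) : MeasurableSet (sectionRange N) :=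
  measurableSet_eq_fun ((measurable_rootSection N).comp (by fun_prop)) measurable_id

theorem finsum_fibre_indicator_sectionRange {M : Type*} [AddCommMonoid M] {N : ℕ} (hN : 0 < N)
    (h : Torus → M) (z : Torus) :
    ∑ᶠ v ∈ {v : Torus | N • v = z}, (sectionRange N).indicator h v = h (rootSection N z) := by
  have hs : rootSection N z ∈ sectionRange N := by
    rw [sectionRange, Set.mem_ofPred_eq, nsmul_rootSection hN]
  rw [finsum_eq_single _ (rootSection N z)]
  · rw [finsum_eq_if, if_pos (show rootSection N z ∈ {v : Torus | N • v = z} from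
      nsmul_rootSection hN z), Set.indicator_of_mem hs]
  · intro v hv
    rw [finsum_eq_if]
    split_ifs with hvz
    · refine Set.indicator_of_notMem (fun hmem => hv ?_) _
      rw [← (show N • v = z from hvz)]
      exact Eq.symm hmem
    · rfl

theorem lintegral_sum_torsion_translates {N : ℕ} {h : Torus → ℝ≥0∞} (hh : AEMeasurable h volume) :
    ∫⁻ w, ∑ k ∈ Finset.range N, h (w + k • torsionStep N) = N * ∫⁻ w, h w := by
  have hm : ∀ k ∈ Finset.range N,
      AEMeasurable (fun w => h (w + k • torsionStep N)) (volume : Measure Torus) := fun k _ =>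
    hh.comp_quasiMeasurePreserving
      (measurePreserving_add_right volume (k • torsionStep N)).quasiMeasurePreserving
  rw [lintegral_finsetSum' _ hm]
  have : ∀ k ∈ Finset.range N, ∫⁻ w, h (w + k • torsionStep N) = ∫⁻ w, h w := fun k _ =>
    lintegral_add_right_eq_self h _
  rw [Finset.sum_congr rfl this, Finset.sum_const, Finset.card_range, nsmul_eq_mul]

theorem lintegral_comp_nsmul {N : ℕ} (hN : 2 ≤ N) {h : Torus → ℝ≥0∞}
    (hh : AEMeasurable h volume) : ∫⁻ w : Torus, h (N • w) = ∫⁻ z, h z := by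
  have hmp := measurePreserving_nsmul_torus hN
  have h' := lintegral_map' (hmp.map_eq.symm ▸ hh) hmp.aemeasurable
  rw [hmp.map_eq] at h'
  exact h'.symm

/-- The section contracts measure by the factor `1 / N`. -/
theorem lintegral_comp_rootSection {N : ℕ} (hN : 2 ≤ N) {h : Torus → ℝ≥0∞}
    (hh : AEMeasurable h volume) :
    ∫⁻ z, h (rootSection N z) = N * ∫⁻ w in sectionRange N, h w := by
  have hN0 : 0 < N := by omega
  have hs : ∫⁻ w : Torus, h (rootSection N (N • w)) = ∫⁻ z, h (rootSection N z) :=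
    lintegral_comp_nsmul hN
      (hh.comp_quasiMeasurePreserving (quasiMeasurePreserving_rootSection hN))
  rw [← hs, ← lintegral_indicator (measurableSet_sectionRange N),
    ← lintegral_sum_torsion_translates (hh.indicator (measurableSet_sectionRange N))]
  congr 1
  ext w
  rw [← finsum_fibre hN0, finsum_fibre_indicator_sectionRange hN0]

theorem measure_compl_sectionRange_ne_zero {N : ℕ} (hN : 2 ≤ N) :
    volume (sectionRange N)ᶜ ≠ 0 := by
  intro h0
  have h1 : ∀ᵐ w : Torus, w ∈ sectionRange N := h0
  have h2 : ∀ᵐ w : Torus, w + torsionStep N ∈ sectionRange N :=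
    (measurePreserving_add_right volume (torsionStep N)).quasiMeasurePreserving.ae h1
  obtain ⟨w, hw1, hw2⟩ := (h1.and h2).exists
  have hw2' : rootSection N (N • (w + torsionStep N)) = w + torsionStep N := hw2
  rw [smul_add, nsmul_torsionStep (by omega), add_zero,
    show rootSection N (N • w) = w from hw1] at hw2'
  exact torsionStep_ne_zero hN (by simpa using hw2'.symm)

/-! ### The transfer operator as a weighted average over fibres -/

/-- The weight `|m₀|² / N` of the transfer operator; under the quadrature condition it restricts to
a probability vector on each fibre of `w ↦ N • w`. -/
def transferWeight (N : ℕ) (m₀ : Torus → ℂ) (w : Torus) : ℝ≥0 := ‖m₀ w‖₊ ^ 2 / N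

theorem transferWeight_eq_zero_iff {N : ℕ} (hN : 0 < N) {m₀ : Torus → ℂ} {w : Torus} :
    transferWeight N m₀ w = 0 ↔ m₀ w = 0 := by
  simp [transferWeight, hN.ne']

theorem continuous_transferWeight (N : ℕ) {m₀ : Torus → ℂ} (hm : Continuous m₀) :
    Continuous (transferWeight N m₀) := by
  unfold transferWeight
  fun_prop

theorem ruelle_nsmul {N : ℕ} (hN : 0 < N) (m₀ f : Torus → ℂ) (w : Torus) :
    ruelle N m₀ f (N • w) = ∑ k ∈ Finset.range N,
      ((transferWeight N m₀ (w + k • torsionStep N) : ℝ) : ℂ) * f (w + k • torsionStep N) := by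
  rw [ruelle, finsum_fibre hN, Finset.mul_sum]
  refine Finset.sum_congr rfl fun k _ => ?_
  simp only [transferWeight]
  push_cast
  ring

theorem ruelle_eq_sum {N : ℕ} (hN : 0 < N) (m₀ f : Torus → ℂ) (z : Torus) :
    ruelle N m₀ f z = ∑ k ∈ Finset.range N,
      ((transferWeight N m₀ (rootSection N z + k • torsionStep N) : ℝ) : ℂ) *
        f (rootSection N z + k • torsionStep N) := by
  rw [← ruelle_nsmul hN, nsmul_rootSection hN]

theorem exists_ne_zero_of_ruelle_ne_zero {N : ℕ} (hN : 0 < N) {m₀ f : Torus → ℂ} {z : Torus}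
    (h : ruelle N m₀ f z ≠ 0) : ∃ w, N • w = z ∧ f w ≠ 0 := by
  rw [ruelle_eq_sum hN] at h
  obtain ⟨k, -, hk⟩ := Finset.exists_ne_zero_of_sum_ne_zero h
  refine ⟨_, ?_, right_ne_zero_of_mul hk⟩
  rw [smul_add, nsmul_rootSection hN, smul_comm, nsmul_torsionStep hN, smul_zero, add_zero]

theorem ruelle_add {N : ℕ} (hN : 0 < N) (m₀ f g : Torus → ℂ) :
    ruelle N m₀ (f + g) = ruelle N m₀ f + ruelle N m₀ g := by
  ext z
  simp [ruelle_eq_sum hN, mul_add, Finset.sum_add_distrib]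

theorem ruelle_smul {N : ℕ} (hN : 0 < N) (m₀ f : Torus → ℂ) (c : ℂ) :
    ruelle N m₀ (c • f) = c • ruelle N m₀ f := by
  ext z
  simp [ruelle_eq_sum hN, Finset.mul_sum, mul_left_comm]

theorem sum_transferWeight {N : ℕ} (hN : 0 < N) {m₀ : Torus → ℂ}
    (hqmf : ∀ z : Torus, ruelle N m₀ (fun _ => 1) z = 1) (w : Torus) :
    ∑ k ∈ Finset.range N, transferWeight N m₀ (w + k • torsionStep N) = 1 := by
  have h := hqmf (N • w)
  rw [ruelle_nsmul hN] at h
  simp only [mul_one] at h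
  exact_mod_cast h

theorem transferWeight_le_one {N : ℕ} (hN : 0 < N) {m₀ : Torus → ℂ}
    (hqmf : ∀ z : Torus, ruelle N m₀ (fun _ => 1) z = 1) (w : Torus) :
    transferWeight N m₀ w ≤ 1 := by
  rw [← sum_transferWeight hN hqmf w]
  have := Finset.single_le_sum
    (f := fun k : ℕ => transferWeight N m₀ (w + k • torsionStep N)) (fun _ _ => zero_le)
    (Finset.mem_range.mpr hN)
  simpa using this

theorem ae_transferWeight_ne_zero {N : ℕ} (hN : 0 < N) {m₀ : Torus → ℂ}
    (hzeros : {z : Torus | m₀ z = 0}.Finite) :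
    ∀ᵐ w : Torus, transferWeight N m₀ w ≠ 0 := by
  refine measure_mono_null (fun w hw => ?_) (hzeros.measure_zero volume)
  exact (transferWeight_eq_zero_iff hN).mp (not_not.mp hw)

theorem ae_transferWeight_ne_one {N : ℕ} (hN : 2 ≤ N) {m₀ : Torus → ℂ}
    (hzeros : {z : Torus | m₀ z = 0}.Finite)
    (hqmf : ∀ z : Torus, ruelle N m₀ (fun _ => 1) z = 1) :
    ∀ᵐ w : Torus, transferWeight N m₀ w ≠ 1 := by
  filter_upwards [(measurePreserving_add_right volume (torsionStep N)).quasiMeasurePreserving.ae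
    (ae_transferWeight_ne_zero (N := N) (by omega) hzeros)] with w hw h1
  have hs := sum_transferWeight (by omega) hqmf w
  have hsub : Finset.range 2 ⊆ Finset.range N := Finset.range_subset_range.mpr hN
  have hle := Finset.sum_le_sum_of_subset (f := fun k : ℕ =>
    transferWeight N m₀ (w + k • torsionStep N)) hsub
  rw [hs, Finset.sum_range_succ, Finset.sum_range_one, zero_smul, add_zero, one_smul, h1] at hle
  exact hw (by simpa using hle)

theorem aestronglyMeasurable_ruelle {N : ℕ} (hN : 2 ≤ N) {m₀ f : Torus → ℂ} (hm : Continuous m₀)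
    (hf : AEStronglyMeasurable f volume) : AEStronglyMeasurable (ruelle N m₀ f) volume := by
  rw [funext (ruelle_eq_sum (by omega : 0 < N) m₀ f)]
  refine Finset.aestronglyMeasurable_fun_sum _ fun k _ => ?_
  have hW : Continuous fun w => ((transferWeight N m₀ w : ℝ) : ℂ) :=
    Complex.continuous_ofReal.comp (NNReal.continuous_coe.comp (continuous_transferWeight N hm))
  have hWf : AEStronglyMeasurable (fun w => ((transferWeight N m₀ w : ℝ) : ℂ) * f w) volume :=
    (hW.aestronglyMeasurable (μ := volume)).mul hf
  exact hWf.comp_quasiMeasurePreserving (quasiMeasurePreserving_rootSection_add hN k)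

theorem ruelle_congr_ae {N : ℕ} (hN : 2 ≤ N) (m₀ : Torus → ℂ) {f g : Torus → ℂ}
    (hfg : f =ᵐ[volume] g) : ruelle N m₀ f =ᵐ[volume] ruelle N m₀ g := by
  have h : ∀ k : ℕ, ∀ᵐ z : Torus, f (rootSection N z + k • torsionStep N) =
      g (rootSection N z + k • torsionStep N) := fun k =>
    (quasiMeasurePreserving_rootSection_add hN k).ae (p := fun w => f w = g w) hfg
  filter_upwards [ae_all_iff.mpr h] with z hz
  simp only [ruelle_eq_sum (by omega : 0 < N), hz]

/-- Jensen's inequality on a fibre. -/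
theorem enorm_ruelle_rpow_le {N : ℕ} (hN : 0 < N) {m₀ : Torus → ℂ}
    (hqmf : ∀ z : Torus, ruelle N m₀ (fun _ => 1) z = 1) {q : ℝ} (hq : 1 ≤ q) (f : Torus → ℂ)
    (w : Torus) :
    ‖ruelle N m₀ f (N • w)‖ₑ ^ q ≤ ∑ k ∈ Finset.range N,
      (transferWeight N m₀ (w + k • torsionStep N) : ℝ≥0∞) *
        ‖f (w + k • torsionStep N)‖ₑ ^ q := by
  have hsum : ∑ k ∈ Finset.range N,
      (transferWeight N m₀ (w + k • torsionStep N) : ℝ≥0∞) = 1 := by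
    exact_mod_cast sum_transferWeight hN hqmf w
  refine le_trans ?_ (ENNReal.rpow_arith_mean_le_arith_mean_rpow (Finset.range N) _
    (fun k => ‖f (w + k • torsionStep N)‖ₑ) hsum hq)
  refine ENNReal.rpow_le_rpow ?_ (by linarith)
  rw [ruelle_nsmul hN]
  refine (enorm_sum_le _ _).trans (Finset.sum_le_sum fun k _ => ?_)
  rw [enorm_mul]
  gcongr
  rw [← ofReal_norm, Complex.norm_real, NNReal.norm_eq, ENNReal.ofReal_coe_nnreal]

theorem lintegral_enorm_ruelle_rpow_le {N : ℕ} (hN : 2 ≤ N) {m₀ : Torus → ℂ} (hm : Continuous m₀)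
    (hqmf : ∀ z : Torus, ruelle N m₀ (fun _ => 1) z = 1) {q : ℝ} (hq : 1 ≤ q) {f : Torus → ℂ}
    (hf : AEStronglyMeasurable f volume) :
    ∫⁻ z, ‖ruelle N m₀ f z‖ₑ ^ q ≤
      N * ∫⁻ w, (transferWeight N m₀ w : ℝ≥0∞) * ‖f w‖ₑ ^ q := by
  have hmeas : AEMeasurable (fun z => ‖ruelle N m₀ f z‖ₑ ^ q) volume :=
    (aestronglyMeasurable_ruelle hN hm hf).enorm.pow_const q
  have hW : AEMeasurable (fun w => (transferWeight N m₀ w : ℝ≥0∞) * ‖f w‖ₑ ^ q) volume :=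
    ((continuous_transferWeight N hm).measurable.coe_nnreal_ennreal.aemeasurable).mul
      (hf.enorm.pow_const q)
  rw [← lintegral_comp_nsmul hN hmeas, ← lintegral_sum_torsion_translates hW]
  exact lintegral_mono fun w => enorm_ruelle_rpow_le (by omega) hqmf hq f w

theorem eLpNorm_ruelle_le {N : ℕ} (hN : 2 ≤ N) {m₀ : Torus → ℂ} (hm : Continuous m₀)
    (hqmf : ∀ z : Torus, ruelle N m₀ (fun _ => 1) z = 1) {p : ℝ≥0∞} (hp1 : 1 ≤ p) (hp : p ≠ ∞)
    {f : Torus → ℂ} (hf : AEStronglyMeasurable f volume) :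
    eLpNorm (ruelle N m₀ f) p volume ≤
      ENNReal.ofReal ((N : ℝ) ^ (1 / p.toReal)) * eLpNorm f p volume := by
  have hp0 : p ≠ 0 := (zero_lt_one.trans_le hp1).ne'
  have hq : 1 ≤ p.toReal := by simpa using ENNReal.toReal_mono hp hp1
  rw [eLpNorm_eq_lintegral_rpow_enorm_toReal hp0 hp, eLpNorm_eq_lintegral_rpow_enorm_toReal hp0 hp,
    ← ENNReal.ofReal_rpow_of_nonneg (Nat.cast_nonneg N) (by positivity), ENNReal.ofReal_natCast,
    ← ENNReal.mul_rpow_of_nonneg _ _ (by positivity)]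
  refine ENNReal.rpow_le_rpow ?_ (by positivity)
  refine (lintegral_enorm_ruelle_rpow_le hN hm hqmf hq hf).trans ?_
  gcongr with w
  refine mul_le_of_le_one_left' ?_
  exact_mod_cast transferWeight_le_one (by omega) hqmf w

theorem memLp_ruelle {N : ℕ} (hN : 2 ≤ N) {m₀ : Torus → ℂ} (hm : Continuous m₀)
    (hqmf : ∀ z : Torus, ruelle N m₀ (fun _ => 1) z = 1) {p : ℝ≥0∞} (hp1 : 1 ≤ p) (hp : p ≠ ∞)
    {f : Torus → ℂ} (hf : MemLp f p volume) : MemLp (ruelle N m₀ f) p volume :=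
  ⟨aestronglyMeasurable_ruelle hN hm hf.1, (eLpNorm_ruelle_le hN hm hqmf hp1 hp hf.1).trans_lt
    (ENNReal.mul_lt_top ENNReal.ofReal_lt_top hf.2)⟩

theorem exists_isRuelleOnLp {N : ℕ} (hN : 2 ≤ N) {m₀ : Torus → ℂ} (hm : Continuous m₀)
    (hqmf : ∀ z : Torus, ruelle N m₀ (fun _ => 1) z = 1) {p : ℝ≥0∞} [hp1 : Fact (1 ≤ p)]
    (hp : p ≠ ∞) :
    ∃ T : Lp ℂ p (volume : Measure Torus) →L[ℂ] Lp ℂ p (volume : Measure Torus),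
      IsRuelleOnLp N m₀ p T ∧ ‖T‖ ≤ (N : ℝ) ^ (1 / p.toReal) := by
  have hN0 : 0 < N := by omega
  have hmem : ∀ f : Lp ℂ p (volume : Measure Torus), MemLp (ruelle N m₀ f) p volume := fun f =>
    memLp_ruelle hN hm hqmf hp1.out hp (Lp.memLp f)
  let L : Lp ℂ p (volume : Measure Torus) →ₗ[ℂ] Lp ℂ p (volume : Measure Torus) :=
    { toFun := fun f => (hmem f).toLp _
      map_add' := fun f g => by
        rw [← MemLp.toLp_add, MemLp.toLp_eq_toLp_iff, ← ruelle_add hN0]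
        exact ruelle_congr_ae hN m₀ (Lp.coeFn_add f g)
      map_smul' := fun c f => by
        rw [RingHom.id_apply, ← MemLp.toLp_const_smul, MemLp.toLp_eq_toLp_iff, ← ruelle_smul hN0]
        exact ruelle_congr_ae hN m₀ (Lp.coeFn_smul c f) }
  have hbound : ∀ f, ‖L f‖ ≤ (N : ℝ) ^ (1 / p.toReal) * ‖f‖ := by
    intro f
    change ‖(hmem f).toLp _‖ ≤ _
    rw [Lp.norm_toLp, Lp.norm_def]
    have h := eLpNorm_ruelle_le hN hm hqmf hp1.out hp (Lp.memLp f).1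
    have h' := ENNReal.toReal_mono
      (ENNReal.mul_ne_top ENNReal.ofReal_ne_top (Lp.memLp f).2.ne) h
    rwa [ENNReal.toReal_mul, ENNReal.toReal_ofReal (by positivity)] at h'
  refine ⟨L.mkContinuous _ hbound, fun f hf => ?_, L.mkContinuous_norm_le (by positivity) hbound⟩
  exact (MemLp.coeFn_toLp (hmem (hf.toLp f))).trans (ruelle_congr_ae hN m₀ hf.coeFn_toLp)

theorem IsRuelleOnLp.coeFn_apply {N : ℕ} {m₀ : Torus → ℂ} {p : ℝ≥0∞} [Fact (1 ≤ p)]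
    {T : Lp ℂ p (volume : Measure Torus) →L[ℂ] Lp ℂ p (volume : Measure Torus)}
    (hT : IsRuelleOnLp N m₀ p T) (f : Lp ℂ p (volume : Measure Torus)) :
    (T f : Torus → ℂ) =ᵐ[volume] ruelle N m₀ f := by
  have h := hT f (Lp.memLp f)
  rwa [Lp.toLp_coeFn] at h

/-- Equality in the norm bound forces `f` to vanish where `|m₀|² < N`, that is, almost
everywhere. -/
theorem IsRuelleOnLp.eq_zero_of_apply_eq_smul {N : ℕ} (hN : 2 ≤ N) {m₀ : Torus → ℂ}
    (hm : Continuous m₀) (hzeros : {z : Torus | m₀ z = 0}.Finite)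
    (hqmf : ∀ z : Torus, ruelle N m₀ (fun _ => 1) z = 1) {p : ℝ≥0∞} [hp1 : Fact (1 ≤ p)]
    (hp : p ≠ ∞) {T : Lp ℂ p (volume : Measure Torus) →L[ℂ] Lp ℂ p (volume : Measure Torus)}
    (hT : IsRuelleOnLp N m₀ p T) {μ : ℂ} (hμ : ‖μ‖ = (N : ℝ) ^ (1 / p.toReal))
    {f : Lp ℂ p (volume : Measure Torus)} (hf : T f = μ • f) : f = 0 := by
  have hN0 : 0 < N := by omega
  have hp0 : p ≠ 0 := (zero_lt_one.trans_le hp1.out).ne'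
  have hq : 1 ≤ p.toReal := by simpa using ENNReal.toReal_mono hp hp1.out
  have hq0 : 0 < p.toReal := by linarith
  have hae : ruelle N m₀ f =ᵐ[volume] μ • (f : Torus → ℂ) :=
    (hT.coeFn_apply f).symm.trans (hf ▸ Lp.coeFn_smul μ f)
  have hμq : ‖μ‖ₑ ^ p.toReal = N := by
    rw [← ofReal_norm, hμ, ENNReal.ofReal_rpow_of_nonneg (by positivity) hq0.le,
      ← Real.rpow_mul (by positivity), one_div_mul_cancel hq0.ne', Real.rpow_one,
      ENNReal.ofReal_natCast]
  have hfq : AEMeasurable (fun w => ‖f w‖ₑ ^ p.toReal) volume :=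
    (Lp.memLp f).1.enorm.pow_const _
  have hle := lintegral_enorm_ruelle_rpow_le hN hm hqmf hq (Lp.memLp f).1
  have heq : ∫⁻ z, ‖ruelle N m₀ f z‖ₑ ^ p.toReal = N * ∫⁻ w, ‖f w‖ₑ ^ p.toReal := by
    rw [← lintegral_const_mul'' _ hfq]
    refine lintegral_congr_ae ?_
    filter_upwards [hae] with z hz
    rw [hz, Pi.smul_apply, enorm_smul, ENNReal.mul_rpow_of_nonneg _ _ hq0.le, hμq]
  rw [heq] at hle
  have hNe : (N : ℝ≥0∞) ≠ 0 := by exact_mod_cast hN0.ne'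
  have hle' := (ENNReal.mul_le_mul_iff_right hNe (ENNReal.natCast_ne_top N)).mp hle
  have hfin : ∫⁻ w, ‖f w‖ₑ ^ p.toReal ≠ ∞ :=
    (lintegral_rpow_enorm_lt_top_of_eLpNorm_lt_top hp0 hp (Lp.memLp f).2).ne
  have hWle : ∀ w, (transferWeight N m₀ w : ℝ≥0∞) * ‖f w‖ₑ ^ p.toReal ≤ ‖f w‖ₑ ^ p.toReal :=
    fun w => mul_le_of_le_one_left' (by exact_mod_cast transferWeight_le_one hN0 hqmf w)
  have haeq := ae_eq_of_ae_le_of_lintegral_le (ae_of_all _ hWle)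
    (ne_top_of_le_ne_top hfin (lintegral_mono hWle)) hfq hle'
  rw [Lp.eq_zero_iff_ae_eq_zero]
  filter_upwards [haeq, ae_transferWeight_ne_one hN hzeros hqmf] with w hw hw1
  by_contra hne
  have hpos : ‖f w‖ₑ ^ p.toReal ≠ 0 := by
    rw [Ne, ENNReal.rpow_eq_zero_iff_of_pos hq0, enorm_eq_zero]
    exact hne
  have htop : ‖f w‖ₑ ^ p.toReal ≠ ∞ := ENNReal.rpow_ne_top_of_nonneg hq0.le enorm_ne_top
  have := (ENNReal.mul_eq_right hpos htop).mp hw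
  exact hw1 (by exact_mod_cast this)

/-! ### A right inverse of the transfer operator and its iterates -/

/-- A right inverse of the transfer operator, carried by a single branch of the `N`-th root: the
function `w ↦ f (N • w) / W(w)` on the range of the section, and `0` elsewhere. Where the weight `W`
vanishes the quotient is `0`; this happens at finitely many points. -/
def branchLift (N : ℕ) (m₀ f : Torus → ℂ) : Torus → ℂ :=
  (sectionRange N).indicator fun w => f (N • w) / ((transferWeight N m₀ w : ℝ) : ℂ)

theorem ruelle_branchLift {N : ℕ} (hN : 0 < N) {m₀ : Torus → ℂ} (f : Torus → ℂ) {z : Torus}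
    (hz : transferWeight N m₀ (rootSection N z) ≠ 0) :
    ruelle N m₀ (branchLift N m₀ f) z = f z := by
  rw [ruelle_eq_sum hN, ← finsum_fibre hN (fun v => ((transferWeight N m₀ v : ℝ) : ℂ) *
    branchLift N m₀ f v), nsmul_rootSection hN]
  have hind : ∀ v, ((transferWeight N m₀ v : ℝ) : ℂ) * branchLift N m₀ f v =
      (sectionRange N).indicator (fun w => ((transferWeight N m₀ w : ℝ) : ℂ) *
        (f (N • w) / ((transferWeight N m₀ w : ℝ) : ℂ))) v := fun v => by
    rw [branchLift, Set.indicator_mul_right]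
  simp only [hind]
  rw [finsum_fibre_indicator_sectionRange hN, nsmul_rootSection hN, mul_div_cancel₀]
  exact_mod_cast hz

theorem ruelle_branchLift_ae {N : ℕ} (hN : 2 ≤ N) {m₀ : Torus → ℂ}
    (hzeros : {z : Torus | m₀ z = 0}.Finite) (f : Torus → ℂ) :
    ruelle N m₀ (branchLift N m₀ f) =ᵐ[volume] f := by
  have h := (quasiMeasurePreserving_rootSection hN).ae (p := fun w => transferWeight N m₀ w ≠ 0)
    (ae_transferWeight_ne_zero (by omega) hzeros)
  filter_upwards [h] with z hz
  exact ruelle_branchLift (by omega) f hz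

theorem mem_of_branchLift_ne_zero {N : ℕ} {m₀ f : Torus → ℂ} {w : Torus}
    (h : branchLift N m₀ f w ≠ 0) : w ∈ sectionRange N ∧ f (N • w) ≠ 0 := by
  obtain ⟨h1, h2⟩ := Set.indicator_apply_ne_zero.mp h
  exact ⟨h1, fun h0 => h2 (by simp [h0])⟩

theorem aestronglyMeasurable_comp_nsmul_div {N : ℕ} (hN : 2 ≤ N) {m₀ f : Torus → ℂ}
    (hm : Continuous m₀) (hf : AEStronglyMeasurable f volume) :
    AEStronglyMeasurable (fun w => f (N • w) / ((transferWeight N m₀ w : ℝ) : ℂ)) volume := by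
  have hW : Continuous fun w => ((transferWeight N m₀ w : ℝ) : ℂ) :=
    Complex.continuous_ofReal.comp (NNReal.continuous_coe.comp (continuous_transferWeight N hm))
  have h1 : AEStronglyMeasurable (fun w : Torus => f (N • w)) volume :=
    hf.comp_quasiMeasurePreserving (measurePreserving_nsmul_torus hN).quasiMeasurePreserving
  exact (h1.aemeasurable.div hW.measurable.aemeasurable).aestronglyMeasurable

theorem eLpNorm_branchLift_le {N : ℕ} (hN : 2 ≤ N) {m₀ : Torus → ℂ} (hm : Continuous m₀)
    {p : ℝ≥0∞} (hp1 : 1 ≤ p) (hp : p ≠ ∞) {f : Torus → ℂ} (hf : AEStronglyMeasurable f volume)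
    {c : ℝ≥0} (hc : c ≠ 0) (hfc : ∀ z, f z ≠ 0 → c ≤ transferWeight N m₀ (rootSection N z)) :
    eLpNorm (branchLift N m₀ f) p volume ≤
      ENNReal.ofReal (((N : ℝ) ^ (1 / p.toReal))⁻¹ * (c : ℝ)⁻¹) * eLpNorm f p volume := by
  have hp0 : p ≠ 0 := (zero_lt_one.trans_le hp1).ne'
  have hq : 1 ≤ p.toReal := by simpa using ENNReal.toReal_mono hp hp1
  have hq0 : 0 < p.toReal := by linarith
  have hN0 : 0 < N := by omega
  have hNe : (N : ℝ≥0∞) ≠ 0 := by exact_mod_cast hN0.ne'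
  have hmeas := aestronglyMeasurable_comp_nsmul_div hN hm hf
  have hcomp := lintegral_comp_rootSection hN (hmeas.enorm.pow_const p.toReal)
  simp only [nsmul_rootSection hN0] at hcomp
  have hbound : ∫⁻ z, ‖f z / ((transferWeight N m₀ (rootSection N z) : ℝ) : ℂ)‖ₑ ^ p.toReal ≤
      ((c : ℝ≥0∞)⁻¹) ^ p.toReal * ∫⁻ z, ‖f z‖ₑ ^ p.toReal := by
    rw [← lintegral_const_mul'' _ (hf.enorm.pow_const _)]
    refine lintegral_mono fun z => ?_
    rw [← ENNReal.mul_rpow_of_nonneg _ _ hq0.le]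
    refine ENNReal.rpow_le_rpow ?_ hq0.le
    by_cases hz : f z = 0
    · simp [hz]
    · have hW := hfc z hz
      have hW0 : transferWeight N m₀ (rootSection N z) ≠ 0 :=
        ((pos_iff_ne_zero.mpr hc).trans_le hW).ne'
      have hinv : ‖((transferWeight N m₀ (rootSection N z) : ℝ) : ℂ)⁻¹‖ₑ ≤ (c : ℝ≥0∞)⁻¹ := by
        rw [enorm_inv (by exact_mod_cast hW0), ← ofReal_norm, Complex.norm_real, NNReal.norm_eq,
          ENNReal.ofReal_coe_nnreal]
        exact ENNReal.inv_le_inv.mpr (by exact_mod_cast hW)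
      rw [div_eq_mul_inv, enorm_mul, mul_comm]
      gcongr
  have hlift : ∫⁻ w, ‖branchLift N m₀ f w‖ₑ ^ p.toReal =
      (N : ℝ≥0∞)⁻¹ * ∫⁻ z, ‖f z / ((transferWeight N m₀ (rootSection N z) : ℝ) : ℂ)‖ₑ ^ p.toReal := by
    rw [hcomp, ← mul_assoc, ENNReal.inv_mul_cancel hNe (ENNReal.natCast_ne_top N), one_mul,
      ← lintegral_indicator (measurableSet_sectionRange N)]
    refine lintegral_congr fun w => ?_
    by_cases hw : w ∈ sectionRange N
    · simp [branchLift, hw]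
    · simp [branchLift, hw, hq0]
  have hconst : ENNReal.ofReal (((N : ℝ) ^ (1 / p.toReal))⁻¹ * (c : ℝ)⁻¹) =
      ((N : ℝ≥0∞)⁻¹ * ((c : ℝ≥0∞)⁻¹) ^ p.toReal) ^ (1 / p.toReal) := by
    rw [ENNReal.mul_rpow_of_nonneg _ _ (by positivity), ← ENNReal.rpow_mul,
      mul_one_div_cancel hq0.ne', ENNReal.rpow_one, ENNReal.inv_rpow,
      ENNReal.ofReal_mul (by positivity), ENNReal.ofReal_inv_of_pos (by positivity),
      ENNReal.ofReal_inv_of_pos (by positivity), ENNReal.ofReal_coe_nnreal,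
      ← ENNReal.ofReal_rpow_of_nonneg (Nat.cast_nonneg N) (by positivity), ENNReal.ofReal_natCast]
  rw [eLpNorm_eq_lintegral_rpow_enorm_toReal hp0 hp, eLpNorm_eq_lintegral_rpow_enorm_toReal hp0 hp,
    hconst, ← ENNReal.mul_rpow_of_nonneg _ _ (by positivity), hlift, mul_assoc]
  refine ENNReal.rpow_le_rpow ?_ (by positivity)
  gcongr

/-- The points whose orbit under the section, from the first step on, stays where the weight is at
least `c`. -/
def goodSet (N : ℕ) (m₀ : Torus → ℂ) (c : ℝ≥0) : Set Torus :=
  {z | ∀ n : ℕ, c ≤ transferWeight N m₀ ((rootSection N)^[n + 1] z)}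

theorem measurableSet_goodSet (N : ℕ) {m₀ : Torus → ℂ} (hm : Continuous m₀) (c : ℝ≥0) :
    MeasurableSet (goodSet N m₀ c) := by
  have : goodSet N m₀ c = ⋂ n : ℕ, {z | c ≤ transferWeight N m₀ ((rootSection N)^[n + 1] z)} := by
    ext z
    simp [goodSet]
  rw [this]
  exact MeasurableSet.iInter fun n => measurableSet_le measurable_const
    ((continuous_transferWeight N hm).measurable.comp ((measurable_rootSection N).iterate (n + 1)))

theorem goodSet_anti (N : ℕ) (m₀ : Torus → ℂ) : Antitone (goodSet N m₀) :=
  fun _ _ hcd _ hz n => hcd.trans (hz n)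

theorem transferWeight_zero {N : ℕ} (hN : 0 < N) {m₀ : Torus → ℂ}
    (hlow : m₀ 0 = (Real.sqrt N : ℂ)) : transferWeight N m₀ 0 = 1 := by
  have h : ‖m₀ 0‖₊ ^ 2 = N := by
    ext
    rw [hlow]
    simp [abs_of_nonneg, Real.sq_sqrt]
  rw [transferWeight, h, div_self]
  exact_mod_cast hN.ne'

/-- All orbits of the section tend to `0` uniformly, and the weight is `1` at `0`. -/
theorem eventually_le_transferWeight_iterate {N : ℕ} (hN : 2 ≤ N) {m₀ : Torus → ℂ}
    (hm : Continuous m₀) (hlow : m₀ 0 = (Real.sqrt N : ℂ)) {r : ℝ≥0} (hr : r < 1) :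
    ∀ᶠ n : ℕ in Filter.atTop, ∀ z, r ≤ transferWeight N m₀ ((rootSection N)^[n] z) := by
  have hnhds : ∀ᶠ z in nhds (0 : Torus), r < transferWeight N m₀ z := by
    refine (continuous_transferWeight N hm).continuousAt.eventually_const_lt ?_
    rwa [transferWeight_zero (by omega) hlow]
  obtain ⟨δ, hδ, hball⟩ := Metric.eventually_nhds_iff.mp hnhds
  have hN1 : (1 : ℝ) < N := by exact_mod_cast hN
  have hlim : Filter.Tendsto (fun n : ℕ => Real.pi / (N : ℝ) ^ n) Filter.atTop (nhds 0) :=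
    (tendsto_pow_atTop_atTop_of_one_lt hN1).const_div_atTop _
  filter_upwards [hlim.eventually_lt_const hδ] with n hn z
  refine (hball ?_).le
  rw [dist_zero_right]
  exact (norm_iterate_rootSection_le (by omega) n z).trans_lt hn

theorem ae_exists_mem_goodSet {N : ℕ} (hN : 2 ≤ N) {m₀ : Torus → ℂ}
    (hm : Continuous m₀) (hlow : m₀ 0 = (Real.sqrt N : ℂ))
    (hzeros : {z : Torus | m₀ z = 0}.Finite) :
    ∀ᵐ z : Torus, ∃ m : ℕ, z ∈ goodSet N m₀ (1 / ((m : ℝ≥0) + 1)) := by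
  have hne : ∀ n : ℕ, ∀ᵐ z : Torus, transferWeight N m₀ ((rootSection N)^[n + 1] z) ≠ 0 := fun n =>
    ((quasiMeasurePreserving_rootSection hN).iterate (n + 1)).ae
      (p := fun w => transferWeight N m₀ w ≠ 0) (ae_transferWeight_ne_zero (by omega) hzeros)
  obtain ⟨n₀, hn₀⟩ := Filter.eventually_atTop.mp
    (eventually_le_transferWeight_iterate hN hm hlow (r := 1 / 2) (by norm_num))
  filter_upwards [ae_all_iff.mpr hne] with z hz
  -- From `n₀` on the weights are at least `1 / 2`; the finitely many earlier ones are positive.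
  have hfin : ∀ K : ℕ, ∃ m : ℕ, ∀ n < K,
      1 / ((m : ℝ≥0) + 1) ≤ transferWeight N m₀ ((rootSection N)^[n + 1] z) := by
    intro K
    induction K with
    | zero => exact ⟨0, by simp⟩
    | succ K ih =>
      obtain ⟨m, hm'⟩ := ih
      obtain ⟨m', hlt⟩ := exists_nat_one_div_lt (pos_iff_ne_zero.mpr (hz K))
      refine ⟨max m m', fun n hn => ?_⟩
      rcases Nat.lt_succ_iff_lt_or_eq.mp hn with h | rfl
      · refine le_trans ?_ (hm' n h)
        gcongr
        exact le_max_left _ _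
      · refine le_trans ?_ hlt.le
        gcongr
        exact le_max_right _ _
  obtain ⟨m, hm'⟩ := hfin n₀
  refine ⟨max m 1, fun n => ?_⟩
  rcases lt_or_ge n n₀ with h | h
  · refine le_trans ?_ (hm' n h)
    gcongr
    exact le_max_left _ _
  · refine le_trans ?_ (hn₀ (n + 1) (by omega) z)
    have : ((1 : ℕ) : ℝ≥0) ≤ ((max m 1 : ℕ) : ℝ≥0) := by exact_mod_cast le_max_right m 1
    refine one_div_le_one_div_of_le (by norm_num) ?_
    calc (2 : ℝ≥0) = ((1 : ℕ) : ℝ≥0) + 1 := by norm_num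
      _ ≤ _ := by gcongr

theorem exists_of_iterate_branchLift_ne_zero {N : ℕ} {m₀ f : Torus → ℂ}
    {n : ℕ} {w : Torus} (h : (branchLift N m₀)^[n] f w ≠ 0) :
    ∃ y, f y ≠ 0 ∧ w = (rootSection N)^[n] y := by
  induction n generalizing w with
  | zero => exact ⟨w, h, rfl⟩
  | succ n ih =>
    rw [Function.iterate_succ_apply'] at h
    obtain ⟨hw, hn⟩ := mem_of_branchLift_ne_zero h
    obtain ⟨y, hy, hyn⟩ := ih hn
    refine ⟨y, hy, ?_⟩
    rw [Function.iterate_succ_apply', ← hyn]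
    exact Eq.symm hw

/-! ### Eigenfunctions -/

theorem memLp_iterate_branchLift {N : ℕ} (hN : 2 ≤ N) {m₀ : Torus → ℂ} (hm : Continuous m₀)
    {p : ℝ≥0∞} (hp1 : 1 ≤ p) (hp : p ≠ ∞) {c : ℝ≥0} (hc : c ≠ 0) {g : Torus → ℂ}
    (hg : MemLp g p volume) (hgc : ∀ z, g z ≠ 0 → z ∈ goodSet N m₀ c) (n : ℕ) :
    MemLp ((branchLift N m₀)^[n] g) p volume := by
  induction n with
  | zero => exact hg
  | succ n ih =>
    rw [Function.iterate_succ_apply']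
    refine ⟨(aestronglyMeasurable_comp_nsmul_div hN hm ih.1).indicator
      (measurableSet_sectionRange N), ?_⟩
    refine (eLpNorm_branchLift_le hN hm hp1 hp ih.1 hc fun z hz => ?_).trans_lt
      (ENNReal.mul_lt_top ENNReal.ofReal_lt_top ih.2)
    obtain ⟨y, hy, rfl⟩ := exists_of_iterate_branchLift_ne_zero hz
    rw [← Function.iterate_succ_apply' (rootSection N)]
    exact hgc y hy n

/-- The equation `T H = g + μ H` is solvable for `g` carried by a good set, by the series
`H = ∑ μ ^ n S ^ (n + 1) g` in the right inverse `S = branchLift N m₀` of `T`. The series converges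
since the ratios of the norms of the iterates are eventually at most `1 / (r N ^ (1 / p))` for any
`r < 1`. -/
theorem IsRuelleOnLp.exists_apply_eq_add_smul {N : ℕ} (hN : 2 ≤ N) {m₀ : Torus → ℂ}
    (hm : Continuous m₀) (hlow : m₀ 0 = (Real.sqrt N : ℂ))
    (hzeros : {z : Torus | m₀ z = 0}.Finite) {p : ℝ≥0∞} [hp1 : Fact (1 ≤ p)] (hp : p ≠ ∞)
    {T : Lp ℂ p (volume : Measure Torus) →L[ℂ] Lp ℂ p (volume : Measure Torus)}
    (hT : IsRuelleOnLp N m₀ p T) {μ : ℂ} (hμ : ‖μ‖ < (N : ℝ) ^ (1 / p.toReal))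
    {c : ℝ≥0} (hc : c ≠ 0) {g : Torus → ℂ} (hg : MemLp g p volume)
    (hgc : ∀ z, g z ≠ 0 → z ∈ goodSet N m₀ c) :
    ∃ H : Lp ℂ p (volume : Measure Torus), T H = hg.toLp g + μ • H ∧
      ∀ᵐ z : Torus, z ∈ (sectionRange N)ᶜ → H z = 0 := by
  have hN0 : 0 < N := by omega
  set B : ℝ := (N : ℝ) ^ (1 / p.toReal)
  have hB : 0 < B := by positivity
  have hu := memLp_iterate_branchLift hN hm hp1.out hp hc hg hgc
  let U : ℕ → Lp ℂ p (volume : Measure Torus) := fun n => (hu n).toLp _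
  have hTU : ∀ n, T (U (n + 1)) = U n := by
    intro n
    refine Lp.ext ((hT _ (hu (n + 1))).trans ?_)
    rw [Function.iterate_succ_apply']
    exact (ruelle_branchLift_ae hN hzeros _).trans (hu n).coeFn_toLp.symm
  -- Any `r` with `|μ| / N ^ (1 / p) < r < 1` makes the ratios of the terms at most
  -- `|μ| / (r N ^ (1 / p)) < 1`.
  obtain ⟨r, hr1, hr2⟩ := exists_between ((div_lt_one hB).mpr hμ)
  have hr0 : 0 < r := (div_nonneg (norm_nonneg μ) hB.le).trans_lt hr1
  have hratio : ∀ᶠ n in Filter.atTop, ‖U (n + 1)‖ ≤ B⁻¹ * r⁻¹ * ‖U n‖ := by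
    have hev := (Filter.tendsto_add_atTop_nat 1).eventually
      (eventually_le_transferWeight_iterate hN hm hlow (r := ⟨r, hr0.le⟩) hr2)
    filter_upwards [hev] with n hn
    change ‖(hu (n + 1)).toLp _‖ ≤ _ * ‖(hu n).toLp _‖
    rw [Lp.norm_toLp, Lp.norm_toLp, Function.iterate_succ_apply']
    have h := eLpNorm_branchLift_le (m₀ := m₀) hN hm hp1.out hp (hu n).1 (c := ⟨r, hr0.le⟩)
      (fun h0 => hr0.ne' (congrArg NNReal.toReal h0)) fun z hz => by
        obtain ⟨y, hy, rfl⟩ := exists_of_iterate_branchLift_ne_zero hz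
        rw [← Function.iterate_succ_apply' (rootSection N)]
        exact hn y
    have h' := ENNReal.toReal_mono (ENNReal.mul_ne_top ENNReal.ofReal_ne_top (hu n).2.ne) h
    rwa [ENNReal.toReal_mul, ENNReal.toReal_ofReal (by positivity)] at h'
  have hρ : ‖μ‖ * (B⁻¹ * r⁻¹) < 1 := by
    rw [← mul_assoc, ← div_eq_mul_inv, ← div_eq_mul_inv]
    exact (div_lt_one hr0).mpr hr1
  have hsum : Summable fun n => μ ^ n • U (n + 1) := by
    refine summable_of_ratio_norm_eventually_le hρ ?_
    filter_upwards [(Filter.tendsto_add_atTop_nat 1).eventually hratio] with n hn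
    rw [norm_smul, norm_smul, pow_succ, norm_mul]
    calc ‖μ ^ n‖ * ‖μ‖ * ‖U (n + 1 + 1)‖
        ≤ ‖μ ^ n‖ * ‖μ‖ * (B⁻¹ * r⁻¹ * ‖U (n + 1)‖) := by gcongr
      _ = _ := by ring
  refine ⟨∑' n, μ ^ n • U (n + 1), ?_, ?_⟩
  · have hsum' : Summable fun n => μ ^ n • U n := by
      rw [← summable_nat_add_iff 1]
      simpa only [pow_succ', mul_smul] using hsum.const_smul μ
    rw [T.map_tsum hsum]
    simp only [map_smul, hTU]
    rw [hsum'.tsum_eq_zero_add, ← hsum.tsum_const_smul μ]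
    simp only [pow_zero, one_smul, pow_succ', mul_smul]
    rfl
  -- Restriction to the complement of the range of the section is continuous and kills every term.
  · let ρA := LpToLpRestrictCLM Torus ℂ ℂ volume p (sectionRange N)ᶜ
    have hzero : ∀ n, ρA (U (n + 1)) = 0 := by
      intro n
      rw [Lp.eq_zero_iff_ae_eq_zero]
      have h1 := LpToLpRestrictCLM_coeFn (μ := volume) ℂ (sectionRange N)ᶜ (U (n + 1))
      filter_upwards [h1, ae_restrict_of_ae (hu (n + 1)).coeFn_toLp,
        ae_restrict_mem (measurableSet_sectionRange N).compl] with z hz1 hz2 hz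
      rw [hz1, hz2]
      by_contra hne
      rw [Pi.zero_apply, Function.iterate_succ_apply'] at hne
      exact hz (mem_of_branchLift_ne_zero hne).1
    have hH : ρA (∑' n, μ ^ n • U (n + 1)) = 0 := by
      rw [ρA.map_tsum hsum]
      simp [hzero]
    have h1 := LpToLpRestrictCLM_coeFn (μ := volume) ℂ (sectionRange N)ᶜ
      (∑' n, μ ^ n • U (n + 1))
    rw [← ae_restrict_iff' (measurableSet_sectionRange N).compl]
    filter_upwards [h1, (Lp.eq_zero_iff_ae_eq_zero.mp hH)] with z hz1 hz2
    rw [← hz1]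
    exact hz2

/-- An eigenfunction with prescribed values `ψ` off the range of the section: with `H` and `K` solving
`T H = ψ + μ H` and `T K = R ψ + μ K`, it is `ψ + μ H - K`. -/
theorem IsRuelleOnLp.exists_eigenvector_extending {N : ℕ} (hN : 2 ≤ N) {m₀ : Torus → ℂ}
    (hm : Continuous m₀) (hlow : m₀ 0 = (Real.sqrt N : ℂ))
    (hzeros : {z : Torus | m₀ z = 0}.Finite)
    (hqmf : ∀ z : Torus, ruelle N m₀ (fun _ => 1) z = 1)
    {p : ℝ≥0∞} [hp1 : Fact (1 ≤ p)] (hp : p ≠ ∞)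
    {T : Lp ℂ p (volume : Measure Torus) →L[ℂ] Lp ℂ p (volume : Measure Torus)}
    (hT : IsRuelleOnLp N m₀ p T) {μ : ℂ} (hμ : ‖μ‖ < (N : ℝ) ^ (1 / p.toReal))
    {c : ℝ≥0} (hc : c ≠ 0) {ψ : Torus → ℂ} (hψ : MemLp ψ p volume)
    (hψc : ∀ z, ψ z ≠ 0 → z ∈ goodSet N m₀ c ∧ N • z ∈ goodSet N m₀ c) :
    ∃ F : Lp ℂ p (volume : Measure Torus), T F = μ • F ∧
      ∀ᵐ z : Torus, z ∈ (sectionRange N)ᶜ → F z = ψ z := by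
  have hN0 : 0 < N := by omega
  have hRψ := memLp_ruelle hN hm hqmf hp1.out hp hψ
  obtain ⟨H, hH, hH0⟩ := hT.exists_apply_eq_add_smul hN hm hlow hzeros hp hμ hc hψ
    fun z hz => (hψc z hz).1
  obtain ⟨K, hK, hK0⟩ := hT.exists_apply_eq_add_smul hN hm hlow hzeros hp hμ hc hRψ
    fun z hz => by
      obtain ⟨w, rfl, hw⟩ := exists_ne_zero_of_ruelle_ne_zero hN0 hz
      exact (hψc w hw).2
  have hTψ : T (hψ.toLp ψ) = hRψ.toLp _ := Lp.ext ((hT ψ hψ).trans hRψ.coeFn_toLp.symm)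
  refine ⟨hψ.toLp ψ + μ • H - K, ?_, ?_⟩
  · rw [map_sub, map_add, map_smul, hTψ, hH, hK, smul_sub, smul_add]
    abel
  · filter_upwards [hH0, hK0, Lp.coeFn_sub (hψ.toLp ψ + μ • H) K,
      Lp.coeFn_add (hψ.toLp ψ) (μ • H), Lp.coeFn_smul μ H, hψ.coeFn_toLp] with
      z h1 h2 h3 h4 h5 h6 hz
    rw [h3, Pi.sub_apply, h4, Pi.add_apply, h5, Pi.smul_apply, h6, h1 hz, h2 hz]
    simp

/-- The set on which the values of an eigenfunction are prescribed: off the range of the section, with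
both `z` and `N • z` good, so that both `ψ` and `R ψ` are carried by the good set. -/
theorem exists_measure_good_ne_zero {N : ℕ} (hN : 2 ≤ N) {m₀ : Torus → ℂ}
    (hm : Continuous m₀) (hlow : m₀ 0 = (Real.sqrt N : ℂ))
    (hzeros : {z : Torus | m₀ z = 0}.Finite) :
    ∃ c : ℝ≥0, c ≠ 0 ∧ volume ((sectionRange N)ᶜ ∩
      (goodSet N m₀ c ∩ (fun z => N • z) ⁻¹' goodSet N m₀ c)) ≠ 0 := by
  by_contra! hcon
  have hnull : ∀ m : ℕ, ∀ᵐ z : Torus, z ∉ (sectionRange N)ᶜ ∩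
      (goodSet N m₀ (1 / ((m : ℝ≥0) + 1)) ∩
        (fun z => N • z) ⁻¹' goodSet N m₀ (1 / ((m : ℝ≥0) + 1))) := fun m =>
    measure_eq_zero_iff_ae_notMem.mp (hcon _ (by positivity))
  have hgood := ae_exists_mem_goodSet hN hm hlow hzeros
  refine measure_compl_sectionRange_ne_zero hN (measure_eq_zero_iff_ae_notMem.mpr ?_)
  filter_upwards [ae_all_iff.mpr hnull, hgood,
    (measurePreserving_nsmul_torus hN).quasiMeasurePreserving.ae
      (p := fun z => ∃ m : ℕ, z ∈ goodSet N m₀ (1 / ((m : ℝ≥0) + 1))) hgood]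
    with z hz ⟨m, hm1⟩ ⟨m', hm2⟩ hzA
  refine hz (max m m') ⟨hzA, goodSet_anti N m₀ ?_ hm1, goodSet_anti N m₀ ?_ hm2⟩
  · gcongr
    exact le_max_left _ _
  · gcongr
    exact le_max_right _ _

/-- A polynomial in `e^{iθ}` that vanishes on a set of positive measure is zero. -/
theorem polynomial_eq_zero_of_ae_eval_toCircle {G : Set Torus} (hG : volume G ≠ 0)
    {P : Polynomial ℂ}
    (hP : ∀ᵐ z : Torus, z ∈ G → P.eval (AddCircle.toCircle z : ℂ) = 0) : P = 0 := by
  by_contra hne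
  have hfin : {z : Torus | P.eval (AddCircle.toCircle z : ℂ) = 0}.Finite := by
    have hinj : Function.Injective fun z : Torus => (AddCircle.toCircle z : ℂ) :=
      Subtype.coe_injective.comp (AddCircle.injective_toCircle Real.two_pi_pos.ne')
    refine ((P.rootSet_finite ℂ).preimage hinj.injOn).subset fun z hz => ?_
    simpa [Polynomial.mem_rootSet, hne] using hz
  refine hG (measure_eq_zero_iff_ae_notMem.mpr ?_)
  filter_upwards [hP, measure_eq_zero_iff_ae_notMem.mp (hfin.measure_zero volume)] with z h1 h2 h3
  exact h2 (h1 h3)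

theorem IsRuelleOnLp.exists_linearIndependent_eigenvectors {N : ℕ} (hN : 2 ≤ N) {m₀ : Torus → ℂ}
    (hm : Continuous m₀) (hlow : m₀ 0 = (Real.sqrt N : ℂ))
    (hzeros : {z : Torus | m₀ z = 0}.Finite)
    (hqmf : ∀ z : Torus, ruelle N m₀ (fun _ => 1) z = 1)
    {p : ℝ≥0∞} [hp1 : Fact (1 ≤ p)] (hp : p ≠ ∞)
    {T : Lp ℂ p (volume : Measure Torus) →L[ℂ] Lp ℂ p (volume : Measure Torus)}
    (hT : IsRuelleOnLp N m₀ p T) {μ : ℂ} (hμ : ‖μ‖ < (N : ℝ) ^ (1 / p.toReal)) :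
    ∃ F : ℕ → Lp ℂ p (volume : Measure Torus), (∀ j, T (F j) = μ • F j) ∧
      LinearIndependent ℂ F := by
  obtain ⟨c, hc, hG⟩ := exists_measure_good_ne_zero hN hm hlow hzeros
  set G := (sectionRange N)ᶜ ∩ (goodSet N m₀ c ∩ (fun z => N • z) ⁻¹' goodSet N m₀ c)
  have hGm : MeasurableSet G := (measurableSet_sectionRange N).compl.inter
    ((measurableSet_goodSet N hm c).inter
      ((measurePreserving_nsmul_torus hN).measurable (measurableSet_goodSet N hm c)))
  have hψ : ∀ j : ℕ, MemLp (G.indicator fun z => (AddCircle.toCircle z : ℂ) ^ j) p volume := by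
    intro j
    have hcont : Continuous fun z : Torus => (AddCircle.toCircle z : ℂ) ^ j :=
      (continuous_subtype_val.comp AddCircle.continuous_toCircle).pow j
    refine MemLp.indicator hGm (MemLp.of_bound hcont.aestronglyMeasurable 1 (ae_of_all _ fun z => ?_))
    rw [norm_pow, Circle.norm_coe, one_pow]
  have hex := fun j => hT.exists_eigenvector_extending hN hm hlow hzeros hqmf hp hμ hc (hψ j)
    fun z hz => (Set.indicator_apply_ne_zero.mp hz).1.2
  choose F hF hFG using hex
  refine ⟨F, hF, linearIndependent_iff'.mpr fun s a ha i hi => ?_⟩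
  have hP : (∑ j ∈ s, Polynomial.monomial j (a j) : Polynomial ℂ) = 0 := by
    refine polynomial_eq_zero_of_ae_eval_toCircle hG ?_
    have hsum : (∑ j ∈ s, a j • (F j : Torus → ℂ)) =ᵐ[volume] 0 := by
      have h0 := (Lp.eq_zero_iff_ae_eq_zero (f := ∑ j ∈ s, a j • F j)).mp ha
      refine Filter.EventuallyEq.trans ?_ h0
      have h1 := Lp.coeFn_finsetSum s fun j => a j • F j
      have h2 : ∀ j, ∀ᵐ z : Torus, (a j • F j) z = a j • F j z := fun j => Lp.coeFn_smul _ _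
      filter_upwards [h1, ae_all_iff.mpr h2] with z hz1 hz2
      rw [hz1, Finset.sum_apply, Finset.sum_apply]
      exact Finset.sum_congr rfl fun j _ => (hz2 j).symm
    filter_upwards [hsum, ae_all_iff.mpr hFG] with z h1 h2 hz
    rw [Finset.sum_apply] at h1
    rw [Polynomial.eval_finsetSum]
    refine Eq.trans (Finset.sum_congr rfl fun j _ => ?_) h1
    rw [Pi.smul_apply, h2 j hz.1, Set.indicator_of_mem hz, Polynomial.eval_monomial, smul_eq_mul]
  have hcoef := congrArg (fun P => Polynomial.coeff P i) hP
  simpa [Polynomial.finsetSum_coeff, Polynomial.coeff_monomial, hi] using hcoef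

end

/-! ### The spectrum -/

theorem ContinuousLinearMap.mem_spectrum_of_hasEigenvalue {E : Type*} [NormedAddCommGroup E]
    [NormedSpace ℂ E] {T : E →L[ℂ] E} {μ : ℂ}
    (h : Module.End.HasEigenvalue (T : Module.End ℂ E) μ) : μ ∈ spectrum ℂ T := by
  obtain ⟨v, hv⟩ := h.exists_hasEigenvector
  have hTv : T v = μ • v := hv.apply_eq_smul
  rw [spectrum.mem_iff]
  rintro ⟨u, hu⟩
  have h0 : (u : E →L[ℂ] E) v = 0 := by
    rw [hu, sub_apply, hTv, ContinuousLinearMap.algebraMap_apply, sub_self]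
  have h1 : ((↑u⁻¹ : E →L[ℂ] E) * (u : E →L[ℂ] E)) v = v := by rw [u.inv_mul]; rfl
  rw [mul_apply_eq_comp, h0, map_zero] at h1
  exact hv.2 h1.symm

theorem theorem2p4 (N : ℕ) (hN : 2 ≤ N) (m₀ : Torus → ℂ)
    (hLip : ∃ K : ℝ≥0, LipschitzWith K m₀)
    (hzeros : {z : Torus | m₀ z = 0}.Finite)
    (hlow : m₀ 0 = (Real.sqrt N : ℂ))
    (hqmf : ∀ z : Torus, ruelle N m₀ (fun _ => 1) z = 1)
    (p : ℝ≥0∞) [Fact (1 ≤ p)] (hp : p ≠ ∞) :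
    ∃ T : Lp ℂ p (volume : Measure Torus) →L[ℂ] Lp ℂ p (volume : Measure Torus),
      IsRuelleOnLp N m₀ p T ∧
      spectralRadius ℂ T = ENNReal.ofReal ((N : ℝ) ^ (1 / p.toReal)) ∧
      spectrum ℂ T = {μ : ℂ | ‖μ‖ ≤ (N : ℝ) ^ (1 / p.toReal)} ∧
      (∀ μ : ℂ, ‖μ‖ < (N : ℝ) ^ (1 / p.toReal) →
        Module.End.HasEigenvalue (T : Module.End ℂ (Lp ℂ p (volume : Measure Torus))) μ ∧
        ¬ FiniteDimensional ℂ
          (Module.End.eigenspace (T : Module.End ℂ (Lp ℂ p (volume : Measure Torus))) μ)) ∧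
      (∀ μ : ℂ, ‖μ‖ = (N : ℝ) ^ (1 / p.toReal) →
        ¬ Module.End.HasEigenvalue (T : Module.End ℂ (Lp ℂ p (volume : Measure Torus))) μ) := by
  obtain ⟨K, hK⟩ := hLip
  have hm : Continuous m₀ := hK.continuous
  have hpos : (0 : ℝ) < (N : ℝ) ^ (1 / p.toReal) := by
    have : 0 < N := by omega
    positivity
  obtain ⟨T, hT, hTnorm⟩ := exists_isRuelleOnLp hN hm hqmf hp
  have heig : ∀ μ : ℂ, ‖μ‖ < (N : ℝ) ^ (1 / p.toReal) →
      Module.End.HasEigenvalue (T : Module.End ℂ (Lp ℂ p (volume : Measure Torus))) μ ∧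
      ¬ FiniteDimensional ℂ
        (Module.End.eigenspace (T : Module.End ℂ (Lp ℂ p (volume : Measure Torus))) μ) := by
    intro μ hμ
    obtain ⟨F, hF, hlin⟩ :=
      hT.exists_linearIndependent_eigenvectors hN hm hlow hzeros hqmf hp hμ
    have hmem : ∀ j, F j ∈ Module.End.eigenspace
        (T : Module.End ℂ (Lp ℂ p (volume : Measure Torus))) μ := fun j =>
      Module.End.mem_eigenspace_iff.mpr (hF j)
    refine ⟨Module.End.hasEigenvalue_of_hasEigenvector ⟨hmem 0, hlin.ne_zero 0⟩, fun hfin => ?_⟩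
    have hlin' : LinearIndependent ℂ fun j => (⟨F j, hmem j⟩ : Module.End.eigenspace
        (T : Module.End ℂ (Lp ℂ p (volume : Measure Torus))) μ) :=
      LinearIndependent.of_comp (Submodule.subtype _) hlin
    exact not_finite_iff_infinite.mpr inferInstance hlin'.finite
  have hspec : spectrum ℂ T = {μ : ℂ | ‖μ‖ ≤ (N : ℝ) ^ (1 / p.toReal)} := by
    apply Set.Subset.antisymm
    · intro μ hμ
      have h := spectrum.subset_closedBall_norm_mul T hμ
      rw [mem_closedBall_zero_iff] at h
      calc ‖μ‖ ≤ ‖T‖ * ‖(1 : Lp ℂ p (volume : Measure Torus) →L[ℂ] _)‖ := h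
        _ ≤ ‖T‖ * 1 := by gcongr; exact ContinuousLinearMap.norm_id_le
        _ ≤ _ := by rwa [mul_one]
    · have hball : Metric.ball (0 : ℂ) ((N : ℝ) ^ (1 / p.toReal)) ⊆ spectrum ℂ T := fun μ hμ =>
        ContinuousLinearMap.mem_spectrum_of_hasEigenvalue
          (heig μ (mem_ball_zero_iff.mp hμ)).1
      have hcl := closure_minimal hball (spectrum.isClosed T)
      rw [closure_ball _ hpos.ne'] at hcl
      exact fun μ hμ => hcl (mem_closedBall_zero_iff.mpr hμ)
  refine ⟨T, hT, ?_, hspec, heig, ?_⟩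
  · apply le_antisymm
    · refine iSup₂_le fun μ hμ => ?_
      rw [hspec] at hμ
      rw [← enorm_eq_nnnorm, ← ofReal_norm]
      exact ENNReal.ofReal_le_ofReal hμ
    · have hnorm : ‖(((N : ℝ) ^ (1 / p.toReal) : ℝ) : ℂ)‖ = (N : ℝ) ^ (1 / p.toReal) := by
        rw [Complex.norm_real, Real.norm_of_nonneg hpos.le]
      have hmem : (((N : ℝ) ^ (1 / p.toReal) : ℝ) : ℂ) ∈ spectrum ℂ T := by
        rw [hspec]
        exact hnorm.le
      refine le_trans (le_of_eq ?_) (le_iSup₂ (α := ℝ≥0∞) _ hmem)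
      rw [← enorm_eq_nnnorm, ← ofReal_norm, hnorm]
  · intro μ hμ h
    obtain ⟨v, hv⟩ := h.exists_hasEigenvector
    exact hv.2 (hT.eq_zero_of_apply_eq_smul hN hm hzeros hqmf hp hμ hv.apply_eq_smul)
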